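/- For an integer $n\ge 3$, let $\mathbb{R}^{\binom{[n]}{2}}$ be the Euclidean space whose coordinates are indexed by the unordered pairs $ij$ with $1\le i\ne j\le n$, and let \[ \mathcal{M}_n=\left\{d\in[0,1]^{\binom{[n]}{2}} \;:\; d_{ij}+d_{jk}-d_{ik}\ge 0 \text{ for all distinct } 1\le i,j,k\le n\right\} \] be the metric polytope, i.e. the set of all (semi)metrics of diameter at most $1$ on $n$ points. An ellipsoid is a set of the form $A\mathbf{B}+c$, where $\mathbf{B}$ is the closed unit ball of $\mathbb{R}^{\binom{[n]}{2}}$, $A$ is a positive semidefinite matrix and $c$ is a vector. For every $n\ge 3$ there is a unique ellipsoid $\mathcal{E}_n$ of largest volume contained in $\mathcal{M}_n$, and, as $n\to\infty$, \[ \min_{d\in\mathcal{E}_n,\ ij\in\binom{[n]}{2}} d_{ij} \;=\; 2-\sqrt{3}+o(1)\;\approx\;0.27+o(1), \] where the minimum is attained for every $n\ge 3$. -/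

import Mathlib

open Filter Topology MeasureTheory

/-- The unordered pairs `ij` with `1 ≤ i ≠ j ≤ n`. -/
abbrev UPair (n : ℕ) : Type := {e : Sym2 (Fin n) // ¬ e.IsDiag}

/-- The unordered pair formed by two distinct points. -/
def upair {n : ℕ} (i j : Fin n) (h : i ≠ j) : UPair n :=
  ⟨s(i, j), by simpa using h⟩

/-- The real Euclidean space whose coordinates are indexed by the unordered pairs. -/
abbrev PairSpace (n : ℕ) : Type := EuclideanSpace ℝ (UPair n)

/-- The metric cone. -/
def metricCone (n : ℕ) : Set (PairSpace n) :=
  {d | ∀ (i j k : Fin n) (hij : i ≠ j) (hjk : j ≠ k) (hik : i ≠ k),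
    0 ≤ d (upair i j hij) ∧ 0 ≤ d (upair i j hij) + d (upair j k hjk) - d (upair i k hik)}

/-- The metric polytope: the part of the metric cone that lies in the unit cube. -/
def metricPolytope (n : ℕ) : Set (PairSpace n) :=
  metricCone n ∩ {d | ∀ e : UPair n, d e ∈ Set.Icc (0 : ℝ) 1}

/-- An ellipsoid: the image of the closed unit ball under `v ↦ A v + c`,
with `A` positive semidefinite. -/
def IsEllipsoid {ι : Type*} [Fintype ι] [DecidableEq ι] (E : Set (EuclideanSpace ℝ ι)) : Prop :=
  ∃ (A : Matrix ι ι ℝ) (c : EuclideanSpace ℝ ι), A.PosSemidef ∧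
    E = (fun v => A.toEuclideanLin v + c) '' Metric.closedBall (0 : EuclideanSpace ℝ ι) 1

/-- `E` is an ellipsoid contained in `K`, and no ellipsoid contained in `K` has larger volume. -/
def IsLargestVolumeEllipsoidIn {ι : Type*} [Fintype ι] [DecidableEq ι]
    (K E : Set (EuclideanSpace ℝ ι)) : Prop :=
  IsEllipsoid E ∧ E ⊆ K ∧
    ∀ E' : Set (EuclideanSpace ℝ ι), IsEllipsoid E' → E' ⊆ K → volume E' ≤ volume E

/-!
The determinant is strictly log-concave on positive definite matrices, so a convex body has at
most one ellipsoid of largest volume: two of them have the same matrix, since otherwise the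
midpoint of the two pairs `(A, c)` would give a larger one (`Matrix.PosDef.eq_of_det_midpoint_le`),
and the same centre, since otherwise the ellipsoid halfway between them could be stretched
(`IsMaxDetPair.unique`). Compactness gives existence (`exists_isMaxDetPair`).

By uniqueness the pair `(A, c)` of the metric polytope is invariant under permutations of the `n`
points. Hence the centre has a constant coordinate `l`, all rows of `A` have the same norm `s`, and
`A` has a constant diagonal entry `p` and a constant entry `q` at two pairs that share a point
(`IsMaxDetPair.exists_parameters`). The least coordinate of a point of the ellipsoid is `l - s`,
and `l + s ≤ 1` because the ellipsoid lies in the unit cube.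

It remains to see that `s ≥ r` and `l ≥ √3 r - o(1)` for `r = 1 / (1 + √3)`. Then
`2 l - 1 ≤ l - s ≤ 1 - 2 s` squeezes `l - s` to `2 √3 r - 1 = 1 - 2 r = 2 - √3`. The ball of
radius `r` around `(√3 r, …, √3 r)` lies in the polytope (`ellipsoid_metricInradius_subset`), so
`det A ≥ r ^ N`, where `N` is the number of pairs. With the inequality of arithmetic and geometric
means for the eigenvalues, `s ≥ p = tr A / N ≥ (det A) ^ (1 / N) ≥ r`. For `l`, the triangle
inequality with normal vector `t` gives `√3 l ≥ ⟨t, A t⟩ = 3 p - 2 q = tr (A S) / N`, where `S` is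
`N` times the average of the matrices `t tᵀ`, and `tr (A S) / N ≥ (det A * det S) ^ (1 / N)`
(`Matrix.PosSemidef.det_mul_det_le_trace_mul`). In terms of the incidence matrix of points and
pairs, `S` differs from a multiple of the identity by a matrix of rank at most `n`, and Sylvester's
identity yields `det S ≥ 3 ^ (N - n)` (`three_pow_card_le_det_triangleGram`). As `n / N → 0`, this
is `√3 l ≥ 3 r - o(1)`.
-/

/-! ### The inequality between the determinant and the trace -/

section DetTrace

variable {ι : Type*} [Fintype ι] [DecidableEq ι]

open scoped MatrixOrder in
theorem Matrix.PosSemidef.exists_eq_conjTranspose_mul_self {S : Matrix ι ι ℝ}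
    (hS : S.PosSemidef) : ∃ B : Matrix ι ι ℝ, S = B.conjTranspose * B :=
  CStarAlgebra.nonneg_iff_eq_star_mul_self.mp hS.nonneg

/-- The inequality of arithmetic and geometric means for the eigenvalues of `X`. -/
theorem Matrix.PosSemidef.det_le_trace_div_card_pow {X : Matrix ι ι ℝ} (hX : X.PosSemidef) :
    X.det ≤ (X.trace / Fintype.card ι) ^ Fintype.card ι := by
  rcases isEmpty_or_nonempty ι with h | h
  · simp
  have hN : (0 : ℝ) < Fintype.card ι := by exact_mod_cast Fintype.card_pos
  have hev := hX.1.posSemidef_iff_eigenvalues_nonneg.1 hX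
  have hprod : 0 ≤ ∏ i, hX.1.eigenvalues i := Finset.prod_nonneg fun i _ => hev i
  have key := Real.geom_mean_le_arith_mean Finset.univ (fun _ : ι => (1 : ℝ)) hX.1.eigenvalues
    (by simp) (by simpa using hN) (fun i _ => hev i)
  simp only [Real.rpow_one, Finset.sum_const, Finset.card_univ, nsmul_eq_mul, mul_one,
    one_mul] at key
  rw [hX.1.det_eq_prod_eigenvalues, hX.1.trace_eq_sum_eigenvalues]
  have := pow_le_pow_left₀ (Real.rpow_nonneg hprod _) key (Fintype.card ι)
  rwa [Real.rpow_inv_natCast_pow hprod Fintype.card_ne_zero] at this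

/-- The equality case of `Matrix.PosSemidef.det_le_trace_div_card_pow`. -/
theorem Matrix.PosSemidef.eq_one_of_trace_le_of_one_le_det {X : Matrix ι ι ℝ}
    (hX : X.PosSemidef) (htr : X.trace ≤ Fintype.card ι) (hdet : 1 ≤ X.det) : X = 1 := by
  have hpos := hX.1.posDef_iff_eigenvalues_pos.1
    (hX.posDef_iff_det_ne_zero.2 (zero_lt_one.trans_le hdet).ne')
  rw [hX.1.trace_eq_sum_eigenvalues] at htr
  rw [hX.1.det_eq_prod_eigenvalues] at hdet
  simp only [RCLike.ofReal_real_eq_id, id] at htr hdet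
  have hlog : 0 ≤ ∑ i, Real.log (hX.1.eigenvalues i) := by
    rw [← Real.log_prod (fun i _ => (hpos i).ne')]
    exact Real.log_nonneg hdet
  have hle : ∀ i ∈ Finset.univ,
      Real.log (hX.1.eigenvalues i) ≤ hX.1.eigenvalues i - 1 :=
    fun i _ => Real.log_le_sub_one_of_pos (hpos i)
  have hsum : ∑ i, (hX.1.eigenvalues i - 1) ≤ 0 := by
    simpa [Finset.sum_sub_distrib] using htr
  have heq := (Finset.sum_eq_sum_iff_of_le hle).1
    (le_antisymm (Finset.sum_le_sum hle) (hsum.trans hlog))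
  have hone : hX.1.eigenvalues = fun _ => 1 := by
    funext i
    by_contra hi
    exact (Real.log_lt_sub_one_of_pos (hpos i) hi).ne (heq i (Finset.mem_univ i))
  rw [hX.1.spectral_theorem, hone]
  have : Matrix.diagonal ((RCLike.ofReal : ℝ → ℝ) ∘ fun _ : ι => (1 : ℝ)) = 1 := by
    simp
  rw [this, map_one]

/-- The inequality of arithmetic and geometric means for `B A Bᵀ`, where `S = Bᵀ B`. -/
theorem Matrix.PosSemidef.det_mul_det_le_trace_mul {A S : Matrix ι ι ℝ} (hA : A.PosSemidef)
    (hS : S.PosSemidef) :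
    A.det * S.det ≤ ((A * S).trace / Fintype.card ι) ^ Fintype.card ι := by
  obtain ⟨B, rfl⟩ := hS.exists_eq_conjTranspose_mul_self
  have h := (hA.mul_mul_conjTranspose_same B).det_le_trace_div_card_pow
  calc A.det * (B.conjTranspose * B).det = (B * A * B.conjTranspose).det := by
        simp only [Matrix.det_mul]; ring
    _ ≤ _ := h
    _ = _ := by rw [← Matrix.mul_assoc A, Matrix.trace_mul_cycle A]

theorem Matrix.PosSemidef.trace_mul_nonneg {A S : Matrix ι ι ℝ} (hA : A.PosSemidef)
    (hS : S.PosSemidef) : 0 ≤ (A * S).trace := by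
  obtain ⟨B, rfl⟩ := hS.exists_eq_conjTranspose_mul_self
  rw [← Matrix.mul_assoc, Matrix.trace_mul_cycle]
  exact (hA.mul_mul_conjTranspose_same B).trace_nonneg

/-- An equality case of `Matrix.PosSemidef.det_mul_det_le_trace_mul`, for `S = M⁻¹`. -/
theorem Matrix.PosSemidef.eq_of_trace_inv_mul_le {A M : Matrix ι ι ℝ} (hA : A.PosSemidef)
    (hM : M.PosDef) (htr : (M⁻¹ * A).trace ≤ Fintype.card ι) (hdet : M.det ≤ A.det) :
    A = M := by
  obtain ⟨B, hB⟩ := hM.inv.posSemidef.exists_eq_conjTranspose_mul_self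
  have hMu : IsUnit M.det := hM.det_pos.ne'.isUnit
  have hBdet : B.conjTranspose.det * B.det = M.det⁻¹ := by
    rw [← Matrix.det_mul, ← hB, Matrix.det_nonsing_inv, Ring.inverse_eq_inv']
  have hBu : IsUnit B.det := by
    refine isUnit_iff_ne_zero.2 fun h => ?_
    rw [h, mul_zero] at hBdet
    exact inv_ne_zero hM.det_pos.ne' hBdet.symm
  have hX : B * A * B.conjTranspose = 1 := by
    refine (hA.mul_mul_conjTranspose_same B).eq_one_of_trace_le_of_one_le_det ?_ ?_
    · rwa [Matrix.trace_mul_comm, ← Matrix.mul_assoc, ← hB]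
    · have : (B * A * B.conjTranspose).det = M.det⁻¹ * A.det := by
        rw [← hBdet, Matrix.det_mul, Matrix.det_mul]; ring
      rw [this, inv_mul_eq_div, one_le_div hM.det_pos]
      exact hdet
  -- `B A Bᵀ = 1` makes `A Bᵀ` the inverse of `B`, hence `A M⁻¹ = A Bᵀ B = 1`.
  have h1 : A * M⁻¹ = 1 := by
    rw [hB, ← Matrix.mul_assoc]
    exact mul_eq_one_comm.1 (by rwa [← Matrix.mul_assoc])
  calc A = A * (M⁻¹ * M) := by rw [Matrix.nonsing_inv_mul _ hMu, mul_one]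
    _ = M := by rw [← mul_assoc, h1, one_mul]

/-- The determinant is strictly log-concave: it grows at the midpoint of two distinct
positive definite matrices with the same determinant. -/
theorem Matrix.PosDef.eq_of_det_midpoint_le {A B : Matrix ι ι ℝ} (hA : A.PosDef)
    (hB : B.PosDef) (hdet : A.det = B.det)
    (hmid : ((1 / 2 : ℝ) • (A + B)).det ≤ A.det) : A = B := by
  set M := (1 / 2 : ℝ) • (A + B) with hMdef
  have hM : M.PosDef := (hA.add hB).smul (by norm_num)
  have hsum : (M⁻¹ * A).trace + (M⁻¹ * B).trace = 2 * Fintype.card ι := by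
    have h2 : A + B = (2 : ℝ) • M := by rw [hMdef, smul_smul]; norm_num
    rw [← Matrix.trace_add, ← mul_add, h2, mul_smul_comm,
      Matrix.nonsing_inv_mul _ hM.det_pos.ne'.isUnit, Matrix.trace_smul, Matrix.trace_one,
      smul_eq_mul]
  have h2 : A + B = M + M := by
    rw [hMdef, ← add_smul]; norm_num
  rcases le_total (M⁻¹ * A).trace (Fintype.card ι) with h | h
  · have hAM := hA.posSemidef.eq_of_trace_inv_mul_le hM h hmid
    rw [← hAM] at h2
    exact (add_left_cancel h2).symm
  · have hBM := hB.posSemidef.eq_of_trace_inv_mul_le hM (by linarith) (hdet ▸ hmid)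
    rw [← hBM] at h2
    exact add_right_cancel h2

/-- Adding a nonzero rank one positive matrix increases the determinant. -/
theorem Matrix.PosDef.det_lt_det_add_vecMulVec {A : Matrix ι ι ℝ} (hA : A.PosDef) {w : ι → ℝ}
    (hw : w ≠ 0) {ε : ℝ} (hε : 0 < ε) : A.det < (A + ε • Matrix.vecMulVec w w).det := by
  have h : A + ε • Matrix.vecMulVec w w =
      A * (1 + Matrix.replicateCol Unit (ε • A⁻¹.mulVec w) * Matrix.replicateRow Unit w) := by
    rw [mul_add, mul_one, ← Matrix.vecMulVec_eq, Matrix.mul_vecMulVec, Matrix.mulVec_smul,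
      Matrix.mulVec_mulVec, Matrix.mul_nonsing_inv _ hA.det_pos.ne'.isUnit, Matrix.one_mulVec,
      Matrix.smul_vecMulVec]
  rw [h, Matrix.det_mul, Matrix.det_one_add_replicateCol_mul_replicateRow, dotProduct_smul]
  have := hA.inv.dotProduct_mulVec_pos hw
  simp only [star_trivial] at this
  have hd := hA.det_pos
  rw [smul_eq_mul, mul_add, mul_one]
  have := mul_pos hd (mul_pos hε this)
  linarith

end DetTrace

/-! ### The ellipsoid of largest volume in a convex body -/

section Ellipsoids

theorem Matrix.isClosed_setOf_posSemidef {ι : Type*} [Fintype ι] :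
    IsClosed {A : Matrix ι ι ℝ | A.PosSemidef} := by
  simp only [Matrix.posSemidef_iff_dotProduct_mulVec, Set.ofPred_and, Set.ofPred_forall]
  refine IsClosed.inter ?_ (isClosed_iInter fun x => ?_)
  · exact isClosed_eq (by fun_prop) continuous_id
  · exact isClosed_le continuous_const (by fun_prop)

variable {ι : Type*} [Fintype ι] [DecidableEq ι]

/-- The image of the closed unit ball under `v ↦ A v + c`. -/
def ellipsoid (A : Matrix ι ι ℝ) (c : EuclideanSpace ℝ ι) : Set (EuclideanSpace ℝ ι) :=
  (fun v => A.toEuclideanLin v + c) '' Metric.closedBall (0 : EuclideanSpace ℝ ι) 1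

theorem ellipsoid_subset_iff {A : Matrix ι ι ℝ} {c : EuclideanSpace ℝ ι}
    {K : Set (EuclideanSpace ℝ ι)} :
    ellipsoid A c ⊆ K ↔ ∀ v : EuclideanSpace ℝ ι, ‖v‖ ≤ 1 → A.toEuclideanLin v + c ∈ K := by
  simp [ellipsoid, Set.subset_def]

theorem Matrix.toEuclideanLin_apply_eq_sum (A : Matrix ι ι ℝ) (v : EuclideanSpace ℝ ι) (i : ι) :
    A.toEuclideanLin v i = ∑ j, A i j * v j := rfl

theorem volume_ellipsoid (A : Matrix ι ι ℝ) (c : EuclideanSpace ℝ ι) :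
    volume (ellipsoid A c) =
      ENNReal.ofReal |A.det| * volume (Metric.closedBall (0 : EuclideanSpace ℝ ι) 1) := by
  have h : ellipsoid A c = (fun x => x + c) ''
      (A.toEuclideanLin '' Metric.closedBall (0 : EuclideanSpace ℝ ι) 1) := by
    rw [Set.image_image]; rfl
  have hdet : LinearMap.det A.toEuclideanLin = A.det := by
    rw [Matrix.toEuclideanLin, Matrix.toLpLin_eq_toLin, LinearMap.det_toLin]
  rw [h, Set.image_add_right, measure_preimage_add_right, Measure.addHaar_image_linearMap, hdet]

/-- `(A, c)` maximizes the determinant among the pairs, with `A` positive semidefinite, that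
parametrize the ellipsoids contained in `K`. -/
structure IsMaxDetPair (K : Set (EuclideanSpace ℝ ι)) (A : Matrix ι ι ℝ)
    (c : EuclideanSpace ℝ ι) : Prop where
  posSemidef : A.PosSemidef
  subset : ellipsoid A c ⊆ K
  det_le : ∀ (A' : Matrix ι ι ℝ) (c' : EuclideanSpace ℝ ι), A'.PosSemidef →
    ellipsoid A' c' ⊆ K → A'.det ≤ A.det

theorem volume_ellipsoid_le_iff {A A' : Matrix ι ι ℝ} {c c' : EuclideanSpace ℝ ι}
    (hA : A.PosSemidef) (hA' : A'.PosSemidef) :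
    volume (ellipsoid A c) ≤ volume (ellipsoid A' c') ↔ A.det ≤ A'.det := by
  have h0 : volume (Metric.closedBall (0 : EuclideanSpace ℝ ι) 1) ≠ 0 :=
    (Metric.measure_closedBall_pos _ _ one_pos).ne'
  have h1 : volume (Metric.closedBall (0 : EuclideanSpace ℝ ι) 1) ≠ ⊤ :=
    measure_closedBall_lt_top.ne
  rw [volume_ellipsoid, volume_ellipsoid, ENNReal.mul_le_mul_iff_left h0 h1,
    abs_of_nonneg hA.det_nonneg, abs_of_nonneg hA'.det_nonneg,
    ENNReal.ofReal_le_ofReal_iff hA'.det_nonneg]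

theorem isLargestVolumeEllipsoidIn_iff {K E : Set (EuclideanSpace ℝ ι)} :
    IsLargestVolumeEllipsoidIn K E ↔ ∃ A c, IsMaxDetPair K A c ∧ E = ellipsoid A c := by
  constructor
  · rintro ⟨⟨A, c, hA, rfl⟩, hsub, hmax⟩
    exact ⟨A, c, ⟨hA, hsub, fun A' c' hA' hsub' =>
      (volume_ellipsoid_le_iff hA' hA).1 (hmax _ ⟨A', c', hA', rfl⟩ hsub')⟩, rfl⟩
  · rintro ⟨A, c, h, rfl⟩
    refine ⟨⟨A, c, h.posSemidef, rfl⟩, h.subset, ?_⟩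
    rintro _ ⟨A', c', hA', rfl⟩ hsub'
    exact (volume_ellipsoid_le_iff hA' h.posSemidef).2 (h.det_le A' c' hA' hsub')

theorem exists_isMaxDetPair {K : Set (EuclideanSpace ℝ ι)} (hK : IsCompact K)
    (hne : K.Nonempty) : ∃ A c, IsMaxDetPair K A c := by
  let F : Set ((ι → ι → ℝ) × EuclideanSpace ℝ ι) :=
    {p | (Matrix.of p.1).PosSemidef ∧ ellipsoid (Matrix.of p.1) p.2 ⊆ K}
  have hcont : Continuous fun p : (ι → ι → ℝ) × EuclideanSpace ℝ ι => Matrix.of p.1 :=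
    continuous_fst
  have hclosed : IsClosed F := by
    refine (Matrix.isClosed_setOf_posSemidef.preimage hcont).inter ?_
    change IsClosed {p : (ι → ι → ℝ) × EuclideanSpace ℝ ι | ellipsoid (Matrix.of p.1) p.2 ⊆ K}
    simp only [ellipsoid_subset_iff, Set.ofPred_forall]
    refine isClosed_iInter fun v => isClosed_iInter fun _ => hK.isClosed.preimage ?_
    refine Continuous.add ?_ continuous_snd
    refine (PiLp.continuous_toLp 2 _).comp ?_
    exact Continuous.matrix_mulVec hcont continuous_const
  have hbdd : Bornology.IsBounded F := by
    obtain ⟨R, hR⟩ := hK.isBounded.exists_norm_le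
    have hc : ∀ p ∈ F, ‖p.2‖ ≤ R := fun p hp => by
      simpa using hR _ (ellipsoid_subset_iff.1 hp.2 0 (by simp))
    have hentry : ∀ p ∈ F, ∀ i j, ‖p.1 i j‖ ≤ 2 * R := fun p hp i j => by
      have h1 := hR _ (ellipsoid_subset_iff.1 hp.2 (EuclideanSpace.single j 1) (by simp))
      have h2 := norm_sub_le ((Matrix.of p.1).toEuclideanLin (EuclideanSpace.single j 1) + p.2) p.2
      rw [add_sub_cancel_right] at h2
      have h3 := PiLp.norm_apply_le ((Matrix.of p.1).toEuclideanLin (EuclideanSpace.single j 1)) i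
      have h4 : (Matrix.of p.1).toEuclideanLin (EuclideanSpace.single j 1) i = p.1 i j := by
        simp [Matrix.toEuclideanLin_apply_eq_sum]
      rw [h4] at h3
      linarith [hc p hp]
    refine (Metric.isBounded_closedBall (x := 0) (r := 2 * R)).subset fun p hp => ?_
    have hR0 : 0 ≤ R := (norm_nonneg _).trans (hc p hp)
    rw [mem_closedBall_zero_iff, Prod.norm_def, max_le_iff]
    refine ⟨?_, by linarith [hc p hp]⟩
    exact (pi_norm_le_iff_of_nonneg (by positivity)).2 fun i =>
      (pi_norm_le_iff_of_nonneg (by positivity)).2 fun j => hentry p hp i j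
  have hFne : F.Nonempty := by
    obtain ⟨x, hx⟩ := hne
    refine ⟨(0, x), Matrix.PosSemidef.zero, ellipsoid_subset_iff.2 fun v _ => ?_⟩
    change Matrix.toEuclideanLin (0 : Matrix ι ι ℝ) v + x ∈ K
    simpa using hx
  obtain ⟨p, hp, hmax⟩ := (Metric.isCompact_of_isClosed_isBounded hclosed hbdd).exists_isMaxOn hFne
    (f := fun p => (Matrix.of p.1).det) hcont.matrix_det.continuousOn
  exact ⟨Matrix.of p.1, p.2, hp.1, hp.2, fun A' c' hA' hsub =>
    hmax (show ((fun i j => A' i j), c') ∈ F from ⟨hA', hsub⟩)⟩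

/-- Strict log-concavity of the determinant determines the matrix. If the same matrix occurred
with two centres, the ellipsoid around their midpoint could be stretched in the direction of
their difference. -/
theorem IsMaxDetPair.unique {K : Set (EuclideanSpace ℝ ι)} (hK : Convex ℝ K)
    {A B : Matrix ι ι ℝ} {c d : EuclideanSpace ℝ ι} (hA : IsMaxDetPair K A c)
    (hB : IsMaxDetPair K B d) (hpos : 0 < A.det) : A = B ∧ c = d := by
  have hdet : A.det = B.det := le_antisymm (hB.det_le _ _ hA.posSemidef hA.subset)
    (hA.det_le _ _ hB.posSemidef hB.subset)
  have hAd : A.PosDef := hA.posSemidef.posDef_iff_det_ne_zero.2 hpos.ne'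
  have hBd : B.PosDef := hB.posSemidef.posDef_iff_det_ne_zero.2 (hdet ▸ hpos.ne')
  have hAB : A = B := by
    refine hAd.eq_of_det_midpoint_le hBd hdet (hA.det_le _ ((1 / 2 : ℝ) • (c + d)) ?_ ?_)
    · exact ((hAd.add hBd).smul (by norm_num : (0 : ℝ) < 1 / 2)).posSemidef
    · refine ellipsoid_subset_iff.2 fun v hv => ?_
      convert hK (ellipsoid_subset_iff.1 hA.subset v hv) (ellipsoid_subset_iff.1 hB.subset v hv)
        (by norm_num : (0 : ℝ) ≤ 1 / 2) (by norm_num : (0 : ℝ) ≤ 1 / 2) (by norm_num) using 1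
      simp only [map_smul, map_add, LinearMap.smul_apply, LinearMap.add_apply]
      module
  subst hAB
  refine ⟨rfl, by_contra fun hcd => ?_⟩
  set w : EuclideanSpace ℝ ι := c - d with hw
  have hw0 : w ≠ 0 := sub_ne_zero.2 hcd
  have hwn : 0 < ‖w‖ := norm_pos_iff.2 hw0
  have hε : (0 : ℝ) < 1 / (2 * ‖w‖) := by positivity
  have hlt := hAd.det_lt_det_add_vecMulVec (w := WithLp.ofLp w)
    (fun h => hw0 (by ext i; exact congrFun h i)) hε
  refine hlt.not_ge (hA.det_le _ ((1 / 2 : ℝ) • (c + d)) ?_ ?_)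
  · have := Matrix.posSemidef_vecMulVec_self_star (R := ℝ) (WithLp.ofLp w)
    rw [star_trivial] at this
    exact hA.posSemidef.add (this.smul hε.le)
  · refine ellipsoid_subset_iff.2 fun v hv => ?_
    set t : ℝ := 1 / (2 * ‖w‖) * inner ℝ v w with ht
    have hin := abs_real_inner_le_norm v w
    have htabs : |t| ≤ 1 / 2 := by
      rw [ht, abs_mul, abs_of_pos hε]
      calc 1 / (2 * ‖w‖) * |inner ℝ v w| ≤ 1 / (2 * ‖w‖) * ‖w‖ := by
            refine mul_le_mul_of_nonneg_left (hin.trans ?_) hε.le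
            exact mul_le_of_le_one_left hwn.le hv
        _ = 1 / 2 := by field_simp
    have htb := abs_le.1 htabs
    have happ : (A + (1 / (2 * ‖w‖)) • Matrix.vecMulVec w.ofLp w.ofLp).toEuclideanLin v =
        A.toEuclideanLin v + t • w := by
      rw [map_add, map_smul, LinearMap.add_apply, LinearMap.smul_apply]
      congr 1
      ext i
      simp only [PiLp.smul_apply, Matrix.toEuclideanLin_apply_eq_sum, Matrix.vecMulVec_apply,
        smul_eq_mul, ht, PiLp.inner_apply, RCLike.inner_apply, conj_trivial, mul_assoc,
        Finset.sum_mul, Finset.mul_sum]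
      exact Finset.sum_congr rfl fun j _ => by ring
    -- `A v + t w + (c + d) / 2` lies on the segment from `A v + d` to `A v + c`.
    convert hK (ellipsoid_subset_iff.1 hA.subset v hv) (ellipsoid_subset_iff.1 hB.subset v hv)
      (by linarith : (0 : ℝ) ≤ 1 / 2 + t) (by linarith : (0 : ℝ) ≤ 1 / 2 - t) (by ring) using 1
    rw [happ, hw]
    module

end Ellipsoids

/-! ### Coordinates of the points of an ellipsoid -/

section Coordinates

variable {ι : Type*} [Fintype ι] [DecidableEq ι]

/-- The `e`-th row of `A`, as a vector of the Euclidean space. -/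
def Matrix.euclideanRow (A : Matrix ι ι ℝ) (e : ι) : EuclideanSpace ℝ ι :=
  WithLp.toLp 2 (A e)

theorem Matrix.toEuclideanLin_apply_eq_inner (A : Matrix ι ι ℝ) (v : EuclideanSpace ℝ ι) (e : ι) :
    A.toEuclideanLin v e = inner ℝ (A.euclideanRow e) v := by
  simp only [Matrix.toEuclideanLin_apply_eq_sum, PiLp.inner_apply, RCLike.inner_apply,
    conj_trivial, Matrix.euclideanRow]
  exact Finset.sum_congr rfl fun j _ => mul_comm _ _

theorem sub_norm_euclideanRow_le {A : Matrix ι ι ℝ} {c d : EuclideanSpace ℝ ι}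
    (hd : d ∈ ellipsoid A c) (e : ι) : c e - ‖A.euclideanRow e‖ ≤ d e := by
  obtain ⟨v, hv, rfl⟩ := hd
  rw [mem_closedBall_zero_iff] at hv
  have h := (abs_le.1 (abs_real_inner_le_norm (A.euclideanRow e) v)).1
  have h2 : ‖A.euclideanRow e‖ * ‖v‖ ≤ ‖A.euclideanRow e‖ :=
    mul_le_of_le_one_right (norm_nonneg _) hv
  change _ ≤ A.toEuclideanLin v e + c e
  rw [A.toEuclideanLin_apply_eq_inner]
  linarith

/-- The extreme values of a coordinate on an ellipsoid are attained at `v = ± r / ‖r‖`, with `r`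
the row of that coordinate. -/
theorem exists_mem_ellipsoid_apply_eq (A : Matrix ι ι ℝ) (c : EuclideanSpace ℝ ι) (e : ι)
    {ε : ℝ} (hε : |ε| = 1) : ∃ d ∈ ellipsoid A c, d e = c e + ε * ‖A.euclideanRow e‖ := by
  set r := A.euclideanRow e with hr
  refine ⟨_, ⟨(ε * ‖r‖⁻¹) • r, ?_, rfl⟩, ?_⟩
  · rw [mem_closedBall_zero_iff, norm_smul, norm_mul, Real.norm_eq_abs, hε, one_mul, norm_inv,
      norm_norm]
    exact inv_mul_le_one
  · change A.toEuclideanLin _ e + c e = _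
    rw [A.toEuclideanLin_apply_eq_inner, ← hr, inner_smul_right, real_inner_self_eq_norm_sq]
    rcases eq_or_ne ‖r‖ 0 with h | h
    · simp [h]
    · field_simp
      ring

end Coordinates

/-! ### The metric polytope and its symmetries -/

section Polytope

variable {n : ℕ}

theorem UPair.exists_eq_upair (e : UPair n) : ∃ i j, ∃ h : i ≠ j, e = upair i j h := by
  obtain ⟨⟨i, j⟩, he⟩ := e
  exact ⟨i, j, by simpa using he, rfl⟩

theorem upair_comm (i j : Fin n) (h : i ≠ j) : upair i j h = upair j i h.symm :=
  Subtype.ext Sym2.eq_swap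

theorem upair_eq_iff {i j k l : Fin n} {h : i ≠ j} {h' : k ≠ l} :
    upair i j h = upair k l h' ↔ i = k ∧ j = l ∨ i = l ∧ j = k := by
  simp [upair, Subtype.ext_iff]

theorem mem_metricPolytope_iff {d : PairSpace n} :
    d ∈ metricPolytope n ↔
      (∀ (i j k : Fin n) (hij : i ≠ j) (hjk : j ≠ k) (hik : i ≠ k),
        0 ≤ d (upair i j hij) + d (upair j k hjk) - d (upair i k hik)) ∧
      ∀ e, 0 ≤ d e ∧ d e ≤ 1 :=
  ⟨fun h => ⟨fun i j k hij hjk hik => (h.1 i j k hij hjk hik).2, h.2⟩,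
    fun h => ⟨fun i j k hij hjk hik => ⟨(h.2 _).1, h.1 i j k hij hjk hik⟩, h.2⟩⟩

theorem convex_metricPolytope : Convex ℝ (metricPolytope n) := by
  intro x hx y hy a b ha hb hab
  rw [mem_metricPolytope_iff] at *
  simp only [PiLp.add_apply, PiLp.smul_apply, smul_eq_mul]
  refine ⟨fun i j k hij hjk hik => ?_, fun e => ⟨?_, ?_⟩⟩
  · linarith [mul_nonneg ha (hx.1 i j k hij hjk hik), mul_nonneg hb (hy.1 i j k hij hjk hik)]
  · linarith [mul_nonneg ha (hx.2 e).1, mul_nonneg hb (hy.2 e).1]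
  · linarith [mul_le_mul_of_nonneg_left (hx.2 e).2 ha, mul_le_mul_of_nonneg_left (hy.2 e).2 hb]

theorem isCompact_metricPolytope : IsCompact (metricPolytope n) := by
  have hcube : IsCompact (WithLp.toLp 2 ''
      Set.pi Set.univ fun _ : UPair n => Set.Icc (0 : ℝ) 1) :=
    (isCompact_univ_pi fun _ => isCompact_Icc).image (PiLp.continuous_toLp 2 _)
  refine hcube.of_isClosed_subset ?_ fun d hd => ⟨WithLp.ofLp d, fun e _ => hd.2 e, rfl⟩
  have : metricPolytope n = {d | ∀ (i j k : Fin n) (hij : i ≠ j) (hjk : j ≠ k) (hik : i ≠ k),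
        0 ≤ d (upair i j hij) + d (upair j k hjk) - d (upair i k hik)} ∩
      {d | ∀ e, 0 ≤ d e ∧ d e ≤ 1} := Set.ext fun d => mem_metricPolytope_iff
  rw [this]
  simp only [Set.ofPred_forall, Set.ofPred_and]
  refine IsClosed.inter ?_ (isClosed_iInter fun e => IsClosed.inter ?_ ?_)
  · exact isClosed_iInter fun i => isClosed_iInter fun j => isClosed_iInter fun k =>
      isClosed_iInter fun _ => isClosed_iInter fun _ => isClosed_iInter fun _ =>
        isClosed_le continuous_const (by fun_prop)
  · exact isClosed_le continuous_const (by fun_prop)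
  · exact isClosed_le (by fun_prop) continuous_const

/-- The permutation of the pairs induced by a permutation of the points. -/
def pairPerm (σ : Equiv.Perm (Fin n)) : Equiv.Perm (UPair n) where
  toFun e := ⟨Sym2.map σ e.1, fun h => e.2 ((Sym2.isDiag_map σ.injective).1 h)⟩
  invFun e := ⟨Sym2.map σ.symm e.1, fun h => e.2 ((Sym2.isDiag_map σ.symm.injective).1 h)⟩
  left_inv e := Subtype.ext (by simp [Sym2.map_map])
  right_inv e := Subtype.ext (by simp [Sym2.map_map])

theorem pairPerm_upair (σ : Equiv.Perm (Fin n)) (i j : Fin n) (h : i ≠ j) :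
    pairPerm σ (upair i j h) = upair (σ i) (σ j) (σ.injective.ne h) := rfl

theorem comp_pairPerm_mem_metricPolytope (σ : Equiv.Perm (Fin n)) {d : PairSpace n}
    (hd : d ∈ metricPolytope n) :
    (WithLp.toLp 2 fun e => d (pairPerm σ e) : PairSpace n) ∈ metricPolytope n := by
  rw [mem_metricPolytope_iff] at *
  exact ⟨fun i j k hij hjk hik => hd.1 (σ i) (σ j) (σ k) (σ.injective.ne hij)
    (σ.injective.ne hjk) (σ.injective.ne hik), fun e => hd.2 _⟩

/-- By uniqueness, the pair of maximal determinant inherits the symmetries of the polytope. -/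
theorem IsMaxDetPair.invariant {A : Matrix (UPair n) (UPair n) ℝ} {c : PairSpace n}
    (h : IsMaxDetPair (metricPolytope n) A c) (hpos : 0 < A.det) (σ : Equiv.Perm (Fin n)) :
    (∀ e f, A (pairPerm σ e) (pairPerm σ f) = A e f) ∧ ∀ e, c (pairPerm σ e) = c e := by
  have hdet : (A.submatrix (pairPerm σ) (pairPerm σ)).det = A.det :=
    Matrix.det_submatrix_equiv_self _ _
  have h' : IsMaxDetPair (metricPolytope n) (A.submatrix (pairPerm σ) (pairPerm σ))
      (WithLp.toLp 2 fun e => c (pairPerm σ e)) := by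
    refine ⟨h.posSemidef.submatrix _, ellipsoid_subset_iff.2 fun v hv => ?_,
      fun A' c' hA' hs => (h.det_le A' c' hA' hs).trans hdet.ge⟩
    have hv' : ‖(WithLp.toLp 2 fun e => v ((pairPerm σ).symm e) : PairSpace n)‖ ≤ 1 := by
      refine le_trans (le_of_eq ?_) hv
      rw [EuclideanSpace.norm_eq, EuclideanSpace.norm_eq]
      congr 1
      exact (pairPerm σ).symm.sum_comp fun e => ‖v e‖ ^ 2
    convert comp_pairPerm_mem_metricPolytope σ (ellipsoid_subset_iff.1 h.subset _ hv') using 1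
    ext e
    change ∑ f, A (pairPerm σ e) (pairPerm σ f) * v f + c (pairPerm σ e) =
      ∑ f, A (pairPerm σ e) f * v ((pairPerm σ).symm f) + c (pairPerm σ e)
    rw [← Equiv.sum_comp (pairPerm σ) fun f => A (pairPerm σ e) f * v ((pairPerm σ).symm f)]
    simp only [Equiv.symm_apply_apply]
  obtain ⟨h1, h2⟩ := h.unique convex_metricPolytope h' hpos
  exact ⟨fun e f => (congrFun (congrFun h1 e) f).symm,
    fun e => (congrArg (fun x => x.ofLp e) h2).symm⟩

theorem exists_pairPerm_eq (e f : UPair n) : ∃ σ : Equiv.Perm (Fin n), pairPerm σ e = f := by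
  obtain ⟨i, j, hij, rfl⟩ := e.exists_eq_upair
  obtain ⟨k, l, hkl, rfl⟩ := f.exists_eq_upair
  obtain ⟨σ, hσ⟩ := Equiv.Perm.exists_extending_pair ![i, j] ![k, l]
    (by simpa [Function.Injective, Fin.forall_fin_two] using ⟨hij, hij.symm⟩)
    (by simpa [Function.Injective, Fin.forall_fin_two] using ⟨hkl, hkl.symm⟩)
  refine ⟨σ, ?_⟩
  have h0 : σ i = k := hσ 0
  have h1 : σ j = l := hσ 1
  simp only [pairPerm_upair, h0, h1]

theorem exists_pairPerm_eq_and_eq {i j k i' j' k' : Fin n} (hij : i ≠ j) (hik : i ≠ k)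
    (hjk : j ≠ k) (hij' : i' ≠ j') (hik' : i' ≠ k') (hjk' : j' ≠ k') :
    ∃ σ : Equiv.Perm (Fin n), pairPerm σ (upair i j hij) = upair i' j' hij' ∧
      pairPerm σ (upair i k hik) = upair i' k' hik' := by
  obtain ⟨σ, hσ⟩ := Equiv.Perm.exists_extending_pair ![i, j, k] ![i', j', k']
    (by intro a b
        fin_cases a <;> fin_cases b <;> simp [hij, hik, hjk, hij.symm, hik.symm, hjk.symm])
    (by intro a b
        fin_cases a <;> fin_cases b <;> simp [hij', hik', hjk', hij'.symm, hik'.symm, hjk'.symm])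
  have h0 : σ i = i' := hσ 0
  have h1 : σ j = j' := hσ 1
  have h2 : σ k = k' := hσ 2
  exact ⟨σ, by simp only [pairPerm_upair, h0, h1], by simp only [pairPerm_upair, h0, h2]⟩

/-- The pair of maximal determinant has a constant centre, and the entries of its matrix on the
diagonal, and at two pairs sharing one point, are constant. -/
theorem IsMaxDetPair.exists_parameters (hn : 3 ≤ n) {A : Matrix (UPair n) (UPair n) ℝ}
    {c : PairSpace n} (h : IsMaxDetPair (metricPolytope n) A c) (hpos : 0 < A.det) :
    ∃ l s p q : ℝ, (∀ e, c e = l) ∧ (∀ e, ‖A.euclideanRow e‖ = s) ∧ (∀ e, A e e = p) ∧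
      ∀ (i j k : Fin n) (hij : i ≠ j) (hik : i ≠ k), j ≠ k →
        A (upair i j hij) (upair i k hik) = q := by
  let x : Fin n := ⟨0, by omega⟩
  let y : Fin n := ⟨1, by omega⟩
  let z : Fin n := ⟨2, by omega⟩
  have hxy : x ≠ y := by simp [x, y]
  have hxz : x ≠ z := by simp [x, z]
  have hyz : y ≠ z := by simp [y, z]
  refine ⟨c (upair x y hxy), ‖A.euclideanRow (upair x y hxy)‖, A (upair x y hxy) (upair x y hxy),
    A (upair x y hxy) (upair x z hxz), fun e => ?_, fun e => ?_, fun e => ?_,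
    fun i j k hij hik hjk => ?_⟩
  · obtain ⟨σ, rfl⟩ := exists_pairPerm_eq (upair x y hxy) e
    exact (h.invariant hpos σ).2 _
  · obtain ⟨σ, rfl⟩ := exists_pairPerm_eq (upair x y hxy) e
    rw [EuclideanSpace.norm_eq, EuclideanSpace.norm_eq]
    congr 1
    rw [← Equiv.sum_comp (pairPerm σ)]
    refine Finset.sum_congr rfl fun f _ => ?_
    change ‖A _ _‖ ^ 2 = ‖A _ _‖ ^ 2
    rw [(h.invariant hpos σ).1]
  · obtain ⟨σ, rfl⟩ := exists_pairPerm_eq (upair x y hxy) e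
    exact (h.invariant hpos σ).1 _ _
  · obtain ⟨σ, h1, h2⟩ := exists_pairPerm_eq_and_eq hxy hxz hyz hij hik hjk
    rw [← h1, ← h2]
    exact (h.invariant hpos σ).1 _ _

/-! ### The largest ball in the metric polytope -/

theorem sq_add_sq_add_sq_le_norm_sq {ι : Type*} [Fintype ι] [DecidableEq ι]
    (v : EuclideanSpace ℝ ι) {a b c : ι} (hab : a ≠ b) (hac : a ≠ c) (hbc : b ≠ c) :
    v a ^ 2 + v b ^ 2 + v c ^ 2 ≤ ‖v‖ ^ 2 := by
  rw [EuclideanSpace.real_norm_sq_eq]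
  refine le_trans (le_of_eq ?_) (Finset.sum_le_sum_of_subset_of_nonneg
    (Finset.subset_univ {a, b, c}) fun i _ _ => sq_nonneg (v i))
  rw [Finset.sum_insert (by simp [hab, hac]), Finset.sum_insert (by simpa using hbc),
    Finset.sum_singleton, add_assoc]

/-- The inradius `1 / (1 + √3)` of the metric polytope. -/
noncomputable def metricInradius : ℝ := (Real.sqrt 3 - 1) / 2

theorem sqrt_three_mul_self : Real.sqrt 3 * Real.sqrt 3 = 3 := Real.mul_self_sqrt (by norm_num)

theorem one_lt_sqrt_three : 1 < Real.sqrt 3 := by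
  rw [Real.lt_sqrt] <;> norm_num

theorem metricInradius_pos : 0 < metricInradius := by
  have := one_lt_sqrt_three
  unfold metricInradius
  linarith

theorem metricInradius_mul : metricInradius * (1 + Real.sqrt 3) = 1 := by
  unfold metricInradius
  linarith [sqrt_three_mul_self]

/-- The ball around `(√3 r, …, √3 r)` of radius `r = metricInradius` touches the facets of both
kinds, whose normal vectors have length `1` and `√3`. -/
theorem ellipsoid_metricInradius_subset :
    ellipsoid (metricInradius • (1 : Matrix (UPair n) (UPair n) ℝ))
      (WithLp.toLp 2 fun _ => Real.sqrt 3 * metricInradius) ⊆ metricPolytope n := by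
  refine ellipsoid_subset_iff.2 fun v hv => ?_
  have happ : ∀ e, ((metricInradius • (1 : Matrix (UPair n) (UPair n) ℝ)).toEuclideanLin v +
      (WithLp.toLp 2 fun _ => Real.sqrt 3 * metricInradius) : PairSpace n) e =
        metricInradius * (v e + Real.sqrt 3) := fun e => by
    rw [PiLp.add_apply, Matrix.toEuclideanLin_apply_eq_sum]
    simp [Matrix.one_apply, mul_add, mul_comm]
  have hr := metricInradius_pos
  have h3 := one_lt_sqrt_three
  rw [mem_metricPolytope_iff]
  simp only [happ]
  refine ⟨fun i j k hij hjk hik => ?_, fun e => ?_⟩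
  · have hsq := sq_add_sq_add_sq_le_norm_sq v
      (a := upair i j hij) (b := upair j k hjk) (c := upair i k hik)
      (by simp [upair_eq_iff, hij, hik, hjk]) (by simp [upair_eq_iff, hij.symm, hjk])
      (by simp [upair_eq_iff, hij.symm, hik.symm])
    have hv2 : ‖v‖ ^ 2 ≤ 1 := pow_le_one₀ (norm_nonneg _) hv
    set a := v (upair i j hij)
    set b := v (upair j k hjk)
    set g := v (upair i k hik)
    have habs : |a + b - g| ≤ Real.sqrt 3 := by
      refine Real.abs_le_sqrt ?_
      nlinarith [sq_nonneg (a - b), sq_nonneg (a + g), sq_nonneg (b + g)]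
    have := (abs_le.1 habs).1
    nlinarith
  · have := abs_le.1 ((PiLp.norm_apply_le v e).trans hv)
    constructor
    · exact mul_nonneg hr.le (by linarith [this.1])
    · rw [← metricInradius_mul]
      exact mul_le_mul_of_nonneg_left (by linarith [this.2]) hr.le

theorem IsMaxDetPair.metricInradius_pow_le {A : Matrix (UPair n) (UPair n) ℝ} {c : PairSpace n}
    (h : IsMaxDetPair (metricPolytope n) A c) :
    metricInradius ^ Fintype.card (UPair n) ≤ A.det := by
  have := h.det_le _ _ (Matrix.PosSemidef.one.smul metricInradius_pos.le)
    ellipsoid_metricInradius_subset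
  rwa [Matrix.det_smul, Matrix.det_one, mul_one] at this

theorem IsMaxDetPair.det_pos {A : Matrix (UPair n) (UPair n) ℝ} {c : PairSpace n}
    (h : IsMaxDetPair (metricPolytope n) A c) : 0 < A.det :=
  (pow_pos metricInradius_pos _).trans_le h.metricInradius_pow_le

end Polytope

/-! ### The averaged triangle inequalities -/

section Incidence

variable {n : ℕ}

/-- The incidence matrix of points and pairs, that is, of the complete graph. -/
def pairIncidence (n : ℕ) : Matrix (Fin n) (UPair n) ℝ :=
  Matrix.of fun v e => if v ∈ e.1 then 1 else 0

theorem sum_pairIncidence_mul (v : Fin n) (f : UPair n → ℝ) :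
    ∑ e, pairIncidence n v e * f e = ∑ j : {j // v ≠ j}, f (upair v j j.2) := by
  simp only [pairIncidence, Matrix.of_apply, ite_mul, one_mul, zero_mul]
  rw [← Finset.sum_filter]
  symm
  refine Finset.sum_bij (fun j _ => upair v j j.2) (fun j _ => ?_) (fun j _ k _ h => ?_)
    (fun e he => ?_) (fun _ _ => rfl)
  · simp [upair]
  · rcases upair_eq_iff.1 h with ⟨_, h⟩ | ⟨h, _⟩
    · exact Subtype.ext h
    · exact absurd h k.2
  · obtain ⟨i, j, hij, rfl⟩ := e.exists_eq_upair
    rcases Sym2.mem_iff.1 (Finset.mem_filter.1 he).2 with rfl | rfl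
    · exact ⟨⟨j, hij⟩, Finset.mem_univ _, rfl⟩
    · exact ⟨⟨i, hij.symm⟩, Finset.mem_univ _, upair_comm _ _ _⟩

theorem card_ne_subtype (v : Fin n) : (Fintype.card {j // v ≠ j} : ℝ) = n - 1 := by
  have hn : 1 ≤ n := by have := v.2; omega
  have h : Fintype.card {j // v ≠ j} = n - 1 := by
    rw [Fintype.card_subtype_compl (fun j => v = j)]
    simp
  rw [h, Nat.cast_sub hn, Nat.cast_one]

theorem pairIncidence_mul_self (v : Fin n) (e : UPair n) :
    pairIncidence n v e * pairIncidence n v e = pairIncidence n v e := by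
  simp [pairIncidence]

theorem pairIncidence_mul_transpose :
    pairIncidence n * (pairIncidence n).transpose =
      ((n : ℝ) - 2) • (1 : Matrix (Fin n) (Fin n) ℝ) + Matrix.of fun _ _ => 1 := by
  ext u v
  rw [Matrix.mul_apply]
  simp only [Matrix.transpose_apply, Matrix.add_apply, Matrix.smul_apply, Matrix.one_apply,
    Matrix.of_apply, smul_eq_mul]
  rw [sum_pairIncidence_mul]
  by_cases h : u = v
  · subst h
    have : ∀ j : {j // u ≠ j}, pairIncidence n u (upair u j j.2) = 1 := fun j => by
      simp [pairIncidence, upair]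
    simp only [this, Finset.sum_const, Finset.card_univ, nsmul_eq_mul, card_ne_subtype, if_true]
    ring
  · rw [Finset.sum_eq_single (⟨v, h⟩ : {j // u ≠ j})]
    · simp [pairIncidence, upair, h]
    · intro j _ hj
      have : v ≠ j := fun hv => hj (Subtype.ext hv.symm)
      simp [pairIncidence, upair, this, Ne.symm h]
    · simp

theorem sum_pairIncidence_left (e : UPair n) : ∑ v, pairIncidence n v e = 2 := by
  obtain ⟨i, j, hij, rfl⟩ := e.exists_eq_upair
  have : ∀ v, pairIncidence n v (upair i j hij) = if v ∈ ({i, j} : Finset (Fin n)) then 1 else 0 :=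
    fun v => by simp [pairIncidence, upair]
  simp only [this, Finset.sum_ite_mem, Finset.univ_inter, Finset.sum_const,
    Finset.card_pair hij]
  norm_num

/-- With `D` the incidence matrix, this is `(3 + 2β) 1 - β Dᵀ D` for `β = 1 / (n - 2)`.
It is the average of the matrices `t tᵀ`, multiplied by the number of pairs, over the normal
vectors `t` of the triangle inequalities: `3` is `‖t‖²`, and the entry `-β` at two pairs sharing
one point comes from the two negative and the one positive product of distinct coordinates
of `t`. -/
noncomputable def triangleGram (n : ℕ) : Matrix (UPair n) (UPair n) ℝ :=
  (3 + 2 / ((n : ℝ) - 2)) • 1 -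
    (1 / ((n : ℝ) - 2)) • ((pairIncidence n).transpose * pairIncidence n)

theorem sum_sq_pairIncidence_mulVec_le (x : UPair n → ℝ) :
    ∑ v, (∑ e, pairIncidence n v e * x e) ^ 2 ≤ 2 * ((n : ℝ) - 1) * ∑ e, x e ^ 2 := by
  have h1 : ∀ v : Fin n, (∑ e, pairIncidence n v e * x e) ^ 2 ≤
      ((n : ℝ) - 1) * ∑ e, pairIncidence n v e * x e ^ 2 := fun v => by
    have hcard : ∑ e, pairIncidence n v e ^ 2 = (n : ℝ) - 1 := by
      have := sum_pairIncidence_mul v fun _ => 1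
      simp only [sq, pairIncidence_mul_self]
      simp only [mul_one, Finset.sum_const, Finset.card_univ, nsmul_eq_mul, card_ne_subtype]
        at this
      exact this
    calc (∑ e, pairIncidence n v e * x e) ^ 2
        = (∑ e, pairIncidence n v e * (pairIncidence n v e * x e)) ^ 2 := by
          simp only [← mul_assoc, pairIncidence_mul_self]
      _ ≤ (∑ e, pairIncidence n v e ^ 2) * ∑ e, (pairIncidence n v e * x e) ^ 2 :=
          Finset.sum_mul_sq_le_sq_mul_sq _ _ _
      _ = _ := by
          rw [hcard]
          congr 1
          refine Finset.sum_congr rfl fun e _ => ?_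
          rw [mul_pow, sq (pairIncidence n v e), pairIncidence_mul_self]
  refine (Finset.sum_le_sum fun v _ => h1 v).trans (le_of_eq ?_)
  rw [← Finset.mul_sum, Finset.sum_comm]
  simp only [← Finset.sum_mul, sum_pairIncidence_left]
  rw [← Finset.mul_sum]
  ring

theorem posSemidef_triangleGram (hn : 3 ≤ n) : (triangleGram n).PosSemidef := by
  have hn' : (0 : ℝ) < (n : ℝ) - 2 := by
    have : (3 : ℝ) ≤ n := by exact_mod_cast hn
    linarith
  refine Matrix.PosSemidef.of_dotProduct_mulVec_nonneg ?_ fun x => ?_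
  · simp only [triangleGram, Matrix.IsHermitian, Matrix.conjTranspose_eq_transpose_of_trivial,
      Matrix.transpose_sub, Matrix.transpose_smul, Matrix.transpose_one, Matrix.transpose_mul,
      Matrix.transpose_transpose]
  · have h1 : x ⬝ᵥ ((pairIncidence n).transpose * pairIncidence n).mulVec x =
        ∑ v, (∑ e, pairIncidence n v e * x e) ^ 2 := by
      rw [← Matrix.mulVec_mulVec, Matrix.dotProduct_mulVec, Matrix.vecMul_transpose]
      exact Finset.sum_congr rfl fun v _ => (sq _).symm
    have h2 : x ⬝ᵥ x = ∑ e, x e ^ 2 := Finset.sum_congr rfl fun e _ => (sq _).symm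
    have hle := sum_sq_pairIncidence_mulVec_le x
    have hx : 0 ≤ ∑ e, x e ^ 2 := Finset.sum_nonneg fun e _ => sq_nonneg _
    rw [star_trivial, triangleGram, Matrix.sub_mulVec, Matrix.smul_mulVec, Matrix.smul_mulVec,
      Matrix.one_mulVec, dotProduct_sub, dotProduct_smul, dotProduct_smul, h1, h2, smul_eq_mul,
      smul_eq_mul]
    have hβ : 0 < 1 / ((n : ℝ) - 2) := by positivity
    -- The largest eigenvalue of `Dᵀ D` is `2 (n - 1)`, which leaves the eigenvalue `1`.
    have h3 : (3 + 2 / ((n : ℝ) - 2)) - 1 / ((n : ℝ) - 2) * (2 * ((n : ℝ) - 1)) = 1 := by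
      field_simp
      ring
    have h4 := mul_le_mul_of_nonneg_left hle hβ.le
    have h5 : (3 + 2 / ((n : ℝ) - 2)) * ∑ e, x e ^ 2 -
        1 / ((n : ℝ) - 2) * (2 * ((n : ℝ) - 1) * ∑ e, x e ^ 2) = ∑ e, x e ^ 2 := by
      rw [← mul_assoc, ← sub_mul, h3, one_mul]
    linarith

/-- All but `n` of the eigenvalues of `triangleGram n` are at least `3`, and Sylvester's
determinant identity reduces the determinant to one of size `n`. -/
theorem three_pow_card_le_det_triangleGram (hn : 3 ≤ n) :
    (3 : ℝ) ^ Fintype.card (UPair n) ≤ 3 ^ n * (triangleGram n).det := by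
  have hn3 : (3 : ℝ) ≤ n := by exact_mod_cast hn
  have hn' : (0 : ℝ) < (n : ℝ) - 2 := by linarith
  set α : ℝ := 3 + 2 / ((n : ℝ) - 2) with hα
  have hα3 : 3 ≤ α := by
    have : 0 < 2 / ((n : ℝ) - 2) := by positivity
    linarith
  have hα0 : α ≠ 0 := by linarith
  have hα1 : α - 1 ≠ 0 := by linarith
  have hS : triangleGram n = α • (1 + (pairIncidence n).transpose *
      ((-(1 / (((n : ℝ) - 2) * α))) • pairIncidence n)) := by
    rw [triangleGram, ← hα, smul_add, Matrix.mul_smul, smul_smul, sub_eq_add_neg, ← neg_smul]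
    congr 2
    field_simp
  have hred : 1 + ((-(1 / (((n : ℝ) - 2) * α))) • pairIncidence n) *
      (pairIncidence n).transpose = (1 - 1 / α) • (1 + Matrix.replicateCol Unit
        (fun _ : Fin n => -(1 / (((n : ℝ) - 2) * (α - 1)))) *
          Matrix.replicateRow Unit fun _ : Fin n => (1 : ℝ)) := by
    rw [Matrix.smul_mul, pairIncidence_mul_transpose]
    ext u v
    simp only [Matrix.add_apply, Matrix.smul_apply, Matrix.of_apply, Matrix.one_apply,
      Matrix.mul_apply, smul_eq_mul, Matrix.replicateCol_apply, Matrix.replicateRow_apply,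
      Finset.univ_unique, Finset.sum_const, Finset.card_singleton, one_smul]
    split_ifs <;> field_simp <;> ring
  have hdet : (triangleGram n).det = α ^ Fintype.card (UPair n) *
      ((1 - 1 / α) ^ n * (((n : ℝ) - 2) / (2 * ((n : ℝ) - 1)))) := by
    rw [hS, Matrix.det_smul, Matrix.det_one_add_mul_comm, hred, Matrix.det_smul,
      Matrix.det_one_add_replicateCol_mul_replicateRow, Fintype.card_fin]
    congr 2
    simp only [dotProduct, one_mul, Finset.sum_const, Finset.card_univ, Fintype.card_fin,
      nsmul_eq_mul]
    have hn1 : (n : ℝ) - 1 ≠ 0 := by linarith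
    have : α - 1 = 2 * ((n : ℝ) - 1) / ((n : ℝ) - 2) := by
      rw [hα]; field_simp; ring
    rw [this]
    field_simp
    ring
  have hquarter : 1 / 4 ≤ ((n : ℝ) - 2) / (2 * ((n : ℝ) - 1)) := by
    rw [div_le_div_iff₀ (by norm_num) (by linarith)]
    linarith
  have hthird : 2 / 3 ≤ 1 - 1 / α := by
    have : 1 / α ≤ 1 / 3 := one_div_le_one_div_of_le (by norm_num) hα3
    linarith
  have h4 : (4 : ℝ) ≤ 2 ^ n := by
    calc (4 : ℝ) = 2 ^ 2 := by norm_num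
      _ ≤ 2 ^ n := pow_le_pow_right₀ (by norm_num) (by omega)
  have hone : 1 ≤ 3 ^ n * ((1 - 1 / α) ^ n * (((n : ℝ) - 2) / (2 * ((n : ℝ) - 1)))) := by
    calc (1 : ℝ) ≤ 2 ^ n * (1 / 4) := by linarith
      _ = 3 ^ n * ((2 / 3) ^ n * (1 / 4)) := by
          rw [← mul_assoc, ← mul_pow]; norm_num
      _ ≤ _ := by gcongr
  rw [hdet, mul_left_comm]
  calc (3 : ℝ) ^ Fintype.card (UPair n) ≤ α ^ Fintype.card (UPair n) * 1 := by
        rw [mul_one]; gcongr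
    _ ≤ _ := by gcongr

theorem two_mul_card_UPair (n : ℕ) : 2 * Fintype.card (UPair n) = n * (n - 1) := by
  rw [Sym2.card_subtype_not_diag, Fintype.card_fin, Nat.choose_two_right]
  exact Nat.mul_div_cancel' (Nat.even_mul_pred_self n).two_dvd

theorem trace_mul_triangleGram (hn : 3 ≤ n) {A : Matrix (UPair n) (UPair n) ℝ} {p q : ℝ}
    (hp : ∀ e, A e e = p) (hq : ∀ (i j k : Fin n) (hij : i ≠ j) (hik : i ≠ k), j ≠ k →
      A (upair i j hij) (upair i k hik) = q) :
    (A * triangleGram n).trace = Fintype.card (UPair n) * (3 * p - 2 * q) := by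
  have hn3 : (3 : ℝ) ≤ n := by exact_mod_cast hn
  have hn' : (n : ℝ) - 2 ≠ 0 := by linarith
  have hcard : 2 * (Fintype.card (UPair n) : ℝ) = n * ((n : ℝ) - 1) := by
    rw [Sym2.card_subtype_not_diag, Fintype.card_fin, Nat.cast_choose_two]
    ring
  have hvertex : ∀ v : Fin n, (pairIncidence n * A * (pairIncidence n).transpose) v v =
      ((n : ℝ) - 1) * (p + ((n : ℝ) - 2) * q) := fun v => by
    have hrow : ∀ j : {j // v ≠ j},
        ∑ k : {k // v ≠ k}, A (upair v k k.2) (upair v j j.2) = p + ((n : ℝ) - 2) * q := fun j => by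
      have hA : ∀ k : {k // v ≠ k}, A (upair v k k.2) (upair v j j.2) =
          q + if k = j then p - q else 0 := fun k => by
        split_ifs with h
        · rw [h, hp]; ring
        · rw [hq v k j k.2 j.2 fun h' => h (Subtype.ext h'), add_zero]
      simp only [hA, Finset.sum_add_distrib, Finset.sum_const, Finset.card_univ, nsmul_eq_mul,
        card_ne_subtype, Finset.sum_ite_eq', Finset.mem_univ, if_true]
      ring
    rw [Matrix.mul_apply]
    simp only [Matrix.transpose_apply, Matrix.mul_apply, sum_pairIncidence_mul]
    simp only [mul_comm _ (pairIncidence n v _), sum_pairIncidence_mul, hrow, Finset.sum_const,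
      Finset.card_univ, nsmul_eq_mul, card_ne_subtype]
  have htr : (A * ((pairIncidence n).transpose * pairIncidence n)).trace =
      n * (((n : ℝ) - 1) * (p + ((n : ℝ) - 2) * q)) := by
    rw [← Matrix.mul_assoc, Matrix.trace_mul_cycle]
    simp only [Matrix.trace, Matrix.diag_apply, hvertex, Finset.sum_const, Finset.card_univ,
      Fintype.card_fin, nsmul_eq_mul]
  have htrA : A.trace = Fintype.card (UPair n) * p := by
    simp only [Matrix.trace, Matrix.diag_apply, hp, Finset.sum_const, Finset.card_univ,
      nsmul_eq_mul]
  rw [triangleGram, mul_sub, Matrix.mul_smul, Matrix.mul_smul, mul_one, Matrix.trace_sub,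
    Matrix.trace_smul, Matrix.trace_smul, htr, htrA, smul_eq_mul, smul_eq_mul, ← mul_assoc (n : ℝ),
    ← hcard]
  field_simp
  ring

end Incidence

/-! ### The parameters of the ellipsoid of largest volume -/

section Limit

variable {n : ℕ}

/-- The triangle inequality at the point of the ellipsoid with parameter `v = - t / √3`, where
`t` is the normal vector of the inequality. -/
theorem three_mul_sub_two_mul_le {A : Matrix (UPair n) (UPair n) ℝ} {c : PairSpace n}
    (h : ellipsoid A c ⊆ metricPolytope n) (hsymm : A.IsHermitian) {l p q : ℝ}
    (hl : ∀ e, c e = l) (hp : ∀ e, A e e = p)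
    (hq : ∀ (i j k : Fin n) (hij : i ≠ j) (hik : i ≠ k), j ≠ k →
      A (upair i j hij) (upair i k hik) = q) (hn : 3 ≤ n) :
    3 * p - 2 * q ≤ Real.sqrt 3 * l := by
  let x : Fin n := ⟨0, by omega⟩
  let y : Fin n := ⟨1, by omega⟩
  let z : Fin n := ⟨2, by omega⟩
  have hxy : x ≠ y := by simp [x, y]
  have hxz : x ≠ z := by simp [x, z]
  have hyz : y ≠ z := by simp [y, z]
  set e := upair x y hxy with he
  set f := upair y z hyz with hf
  set g := upair x z hxz with hg
  have hAef : A e f = q := by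
    rw [he, hf, upair_comm x y]; exact hq y x z _ _ hxz
  have hAeg : A e g = q := hq x y z _ _ hyz
  have hAfg : A f g = q := by
    rw [hf, hg, upair_comm y z, upair_comm x z]; exact hq z y x _ _ hxy.symm
  have hAfe : A f e = q := by rw [← hAef]; exact hsymm.apply e f
  have hAge : A g e = q := by rw [← hAeg]; exact hsymm.apply e g
  have hAgf : A g f = q := by rw [← hAfg]; exact hsymm.apply f g
  have hef : e ≠ f := by simp [he, hf, upair_eq_iff, hxy, hxz]
  have heg : e ≠ g := by simp [he, hg, upair_eq_iff, hyz, hxz]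
  have hfg : f ≠ g := by simp [hf, hg, upair_eq_iff, hxy.symm, hyz]
  set t : PairSpace n := EuclideanSpace.single e 1 + EuclideanSpace.single f 1 -
    EuclideanSpace.single g 1 with ht
  have happ : ∀ u, A.toEuclideanLin t u = A u e + A u f - A u g := fun u => by
    simp [ht, Matrix.toEuclideanLin_apply_eq_sum]
  have hnorm : ‖t‖ ^ 2 = 3 := by
    rw [← real_inner_self_eq_norm_sq, ht]
    simp only [inner_sub_left, inner_add_left, EuclideanSpace.inner_single_left, map_one, one_mul,
      PiLp.sub_apply, PiLp.add_apply, PiLp.single_apply, hef, heg, hfg, hef.symm, heg.symm,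
      hfg.symm, if_true, if_false]
    norm_num
  have h3 : 0 < Real.sqrt 3 := one_lt_sqrt_three.trans' one_pos
  have htn : ‖t‖ = Real.sqrt 3 := by rw [← hnorm, Real.sqrt_sq (norm_nonneg _)]
  have hmem := ellipsoid_subset_iff.1 h ((-(Real.sqrt 3)⁻¹) • t) (by
    rw [norm_smul, htn, norm_neg, norm_inv, Real.norm_eq_abs, abs_of_pos h3,
      inv_mul_cancel₀ h3.ne'])
  have := (mem_metricPolytope_iff.1 hmem).1 x y z hxy hyz hxz
  rw [← he, ← hf, ← hg, map_smul] at this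
  simp only [PiLp.add_apply, PiLp.smul_apply, happ, smul_eq_mul, hl, hp, hAef, hAeg, hAfg, hAfe,
    hAge, hAgf] at this
  have h5 : 0 ≤ Real.sqrt 3 * (l - (Real.sqrt 3)⁻¹ * (3 * p - 2 * q)) :=
    mul_nonneg h3.le (by linarith)
  rw [mul_sub, ← mul_assoc, mul_inv_cancel₀ h3.ne', one_mul] at h5
  linarith

/-- Bounds on the constant value `l` of the centre and on the half-width `s` of the ellipsoid of
largest volume in each coordinate. The bound on `s` is the comparison with the ball of radius
`metricInradius`. The last bound applies `Matrix.PosSemidef.det_mul_det_le_trace_mul` to `A` and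
`triangleGram n`, whose product has trace at most `√3 l` times the number of pairs. -/
theorem IsMaxDetPair.parameter_bounds (hn : 3 ≤ n) {A : Matrix (UPair n) (UPair n) ℝ}
    {c : PairSpace n} (h : IsMaxDetPair (metricPolytope n) A c) {l s : ℝ}
    (hl : ∀ e, c e = l) (hs : ∀ e, ‖A.euclideanRow e‖ = s) {p q : ℝ} (hp : ∀ e, A e e = p)
    (hq : ∀ (i j k : Fin n) (hij : i ≠ j) (hik : i ≠ k), j ≠ k →
      A (upair i j hij) (upair i k hik) = q) :
    0 ≤ l ∧ l + s ≤ 1 ∧ metricInradius ≤ s ∧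
      (Real.sqrt 3 * metricInradius) ^ Fintype.card (UPair n) ≤
        3 ^ n * l ^ Fintype.card (UPair n) := by
  set N := Fintype.card (UPair n) with hN
  have h3 : 0 < Real.sqrt 3 := one_lt_sqrt_three.trans' one_pos
  let e : UPair n := upair ⟨0, by omega⟩ ⟨1, by omega⟩ (by simp)
  have hN0 : N ≠ 0 := by
    have : Nonempty (UPair n) := ⟨e⟩
    exact Fintype.card_ne_zero
  have hN0' : (N : ℝ) ≠ 0 := by exact_mod_cast hN0
  have hr := metricInradius_pos
  have hps : p ≤ s := by
    rw [← hs e, ← hp e]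
    exact (le_abs_self _).trans (PiLp.norm_apply_le (A.euclideanRow e) e)
  have hp0 : 0 ≤ p := by rw [← hp e]; exact h.posSemidef.diag_nonneg
  have hrp : metricInradius ≤ p := by
    refine le_of_pow_le_pow_left₀ hN0 hp0 (h.metricInradius_pow_le.trans ?_)
    refine h.posSemidef.det_le_trace_div_card_pow.trans (le_of_eq ?_)
    simp only [Matrix.trace, Matrix.diag_apply, hp, Finset.sum_const, Finset.card_univ,
      nsmul_eq_mul]
    rw [mul_div_cancel_left₀ _ hN0']
  have hls : l + s ≤ 1 := by
    obtain ⟨d, hd, hde⟩ := exists_mem_ellipsoid_apply_eq A c e (ε := 1) (by simp)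
    have := ((h.subset hd).2 e).2
    rw [hde, hl, hs] at this
    linarith
  have htri := three_mul_sub_two_mul_le h.subset h.posSemidef.1 hl hp hq hn
  have htr := trace_mul_triangleGram hn hp hq
  have hpq : 0 ≤ 3 * p - 2 * q := by
    have := h.posSemidef.trace_mul_nonneg (posSemidef_triangleGram hn)
    rw [htr] at this
    exact nonneg_of_mul_nonneg_right this (by positivity)
  have hl0 : 0 ≤ l := nonneg_of_mul_nonneg_right (hpq.trans htri) h3
  refine ⟨hl0, hls, hrp.trans hps, ?_⟩
  have hamgm := h.posSemidef.det_mul_det_le_trace_mul (posSemidef_triangleGram hn)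
  rw [htr, mul_div_cancel_left₀ _ hN0'] at hamgm
  have hdet := three_pow_card_le_det_triangleGram hn
  have hG := (posSemidef_triangleGram hn).det_nonneg
  have hmain : (Real.sqrt 3 * (Real.sqrt 3 * metricInradius)) ^ N ≤
      3 ^ n * (Real.sqrt 3 * l) ^ N := by
    calc (Real.sqrt 3 * (Real.sqrt 3 * metricInradius)) ^ N
        = metricInradius ^ N * 3 ^ N := by
          rw [← mul_assoc, sqrt_three_mul_self, mul_pow, mul_comm]
      _ ≤ A.det * (3 ^ n * (triangleGram n).det) :=
          mul_le_mul h.metricInradius_pow_le hdet (by positivity) h.posSemidef.det_nonneg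
      _ = 3 ^ n * (A.det * (triangleGram n).det) := by ring
      _ ≤ 3 ^ n * (Real.sqrt 3 * l) ^ N := by
          gcongr
          exact hamgm.trans (pow_le_pow_left₀ hpq htri _)
  rw [mul_pow (Real.sqrt 3), mul_pow (Real.sqrt 3) l, mul_left_comm] at hmain
  exact le_of_mul_le_mul_left hmain (by positivity)

/-- Since there are `n (n - 1) / 2` pairs, the factor `3 ^ n` costs only `9 ^ (1 / (n - 1))`. -/
theorem mul_rpow_le_of_pow_card_le (hn : 3 ≤ n) {a l : ℝ} (ha : 0 < a) (hl : 0 ≤ l)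
    (h : a ^ Fintype.card (UPair n) ≤ 3 ^ n * l ^ Fintype.card (UPair n)) :
    a * (1 / 9 : ℝ) ^ ((1 : ℝ) / ((n - 1 : ℕ) : ℝ)) ≤ l := by
  have hcard := two_mul_card_UPair n
  have h2 : (a ^ (n - 1)) ^ n ≤ (9 * l ^ (n - 1)) ^ n := by
    calc (a ^ (n - 1)) ^ n = (a ^ Fintype.card (UPair n)) ^ 2 := by
          rw [← pow_mul, ← pow_mul, mul_comm (n - 1), ← hcard, mul_comm 2]
      _ ≤ (3 ^ n * l ^ Fintype.card (UPair n)) ^ 2 := by gcongr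
      _ = (9 * l ^ (n - 1)) ^ n := by
          rw [mul_pow, mul_pow, ← pow_mul, ← pow_mul, ← pow_mul,
            mul_comm (Fintype.card (UPair n)) 2, hcard, mul_comm n 2, pow_mul 3 2,
            mul_comm n (n - 1)]
          norm_num
  have h3 : a ^ (n - 1) ≤ 9 * l ^ (n - 1) :=
    le_of_pow_le_pow_left₀ (by omega) (by positivity) h2
  refine le_of_pow_le_pow_left₀ (show n - 1 ≠ 0 by omega) hl ?_
  rw [mul_pow, one_div ((n - 1 : ℕ) : ℝ), Real.rpow_inv_natCast_pow (by norm_num) (by omega)]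
  linarith

theorem tendsto_rpow_one_div_sub_one :
    Tendsto (fun n : ℕ => (1 / 9 : ℝ) ^ ((1 : ℝ) / ((n - 1 : ℕ) : ℝ))) atTop (𝓝 1) := by
  have h : Tendsto (fun n : ℕ => (1 : ℝ) / ((n - 1 : ℕ) : ℝ)) atTop (𝓝 0) :=
    tendsto_one_div_atTop_nhds_zero_nat.comp (tendsto_sub_atTop_nat 1)
  have := (Real.continuousAt_const_rpow (a := (1 / 9 : ℝ)) (b := 0) (by norm_num)).tendsto.comp h
  simpa [Function.comp_def] using this

theorem exists_isMaxDetPair_metricPolytope (n : ℕ) :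
    ∃ A c, IsMaxDetPair (metricPolytope n) A c :=
  exists_isMaxDetPair isCompact_metricPolytope
    ⟨_, ellipsoid_subset_iff.1 ellipsoid_metricInradius_subset 0 (by simp)⟩

theorem existsUnique_isLargestVolumeEllipsoidIn_metricPolytope (n : ℕ) :
    ∃! E : Set (PairSpace n), IsLargestVolumeEllipsoidIn (metricPolytope n) E := by
  obtain ⟨A, c, h⟩ := exists_isMaxDetPair_metricPolytope n
  refine ⟨ellipsoid A c, isLargestVolumeEllipsoidIn_iff.2 ⟨A, c, h, rfl⟩, fun E hE => ?_⟩
  obtain ⟨A', c', h', rfl⟩ := isLargestVolumeEllipsoidIn_iff.1 hE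
  obtain ⟨rfl, rfl⟩ := h.unique convex_metricPolytope h' h.det_pos
  rfl

theorem exists_isLeast_coordinate (hn : 3 ≤ n) :
    ∃ m : ℝ, (∀ E : Set (PairSpace n), IsLargestVolumeEllipsoidIn (metricPolytope n) E →
        IsLeast {x : ℝ | ∃ d ∈ E, ∃ e : UPair n, x = d e} m) ∧
      2 * (Real.sqrt 3 * metricInradius * (1 / 9 : ℝ) ^ ((1 : ℝ) / ((n - 1 : ℕ) : ℝ))) - 1 ≤ m ∧
      m ≤ 2 - Real.sqrt 3 := by
  obtain ⟨A, c, h⟩ := exists_isMaxDetPair_metricPolytope n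
  obtain ⟨l, s, p, q, hl, hs, hp, hq⟩ := h.exists_parameters hn h.det_pos
  obtain ⟨hl0, hls, hrs, hpow⟩ := h.parameter_bounds hn hl hs hp hq
  refine ⟨l - s, fun E hE => ?_, ?_, ?_⟩
  · obtain rfl := (existsUnique_isLargestVolumeEllipsoidIn_metricPolytope n).unique hE
      (isLargestVolumeEllipsoidIn_iff.2 ⟨A, c, h, rfl⟩)
    refine ⟨?_, ?_⟩
    · let e : UPair n := upair ⟨0, by omega⟩ ⟨1, by omega⟩ (by simp)
      obtain ⟨d, hd, hde⟩ := exists_mem_ellipsoid_apply_eq A c e (ε := -1) (by simp)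
      exact ⟨d, hd, e, by rw [hde, hl, hs]; ring⟩
    · rintro x ⟨d, hd, e, rfl⟩
      rw [← hl e, ← hs e]
      exact sub_norm_euclideanRow_le hd e
  · have := mul_rpow_le_of_pow_card_le hn
      (mul_pos (one_pos.trans one_lt_sqrt_three) metricInradius_pos) hl0 hpow
    linarith
  · unfold metricInradius at hrs
    linarith

end Limit

theorem corollary4 :
    (∀ n : ℕ, 3 ≤ n →
      ∃! E : Set (PairSpace n), IsLargestVolumeEllipsoidIn (metricPolytope n) E) ∧
    (∃ m : ℕ → ℝ,
      (∀ n : ℕ, 3 ≤ n → ∀ E : Set (PairSpace n),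
        IsLargestVolumeEllipsoidIn (metricPolytope n) E →
          IsLeast {x : ℝ | ∃ d ∈ E, ∃ e : UPair n, x = d e} (m n)) ∧
      Tendsto m atTop (𝓝 (2 - Real.sqrt 3))) ∧
    |(2 - Real.sqrt 3) - 0.27| < 0.005 := by
  refine ⟨fun n _ => existsUnique_isLargestVolumeEllipsoidIn_metricPolytope n, ?_, ?_⟩
  · have hex : ∀ n : ℕ, ∃ m : ℝ, 3 ≤ n →
        (∀ E : Set (PairSpace n), IsLargestVolumeEllipsoidIn (metricPolytope n) E →
          IsLeast {x : ℝ | ∃ d ∈ E, ∃ e : UPair n, x = d e} m) ∧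
        2 * (Real.sqrt 3 * metricInradius * (1 / 9 : ℝ) ^ ((1 : ℝ) / ((n - 1 : ℕ) : ℝ))) - 1 ≤ m ∧
        m ≤ 2 - Real.sqrt 3 := fun n => by
      by_cases hn : 3 ≤ n
      · exact (exists_isLeast_coordinate hn).imp fun _ h _ => h
      · exact ⟨0, fun h => absurd h hn⟩
    choose m hm using hex
    refine ⟨m, fun n hn => (hm n hn).1, ?_⟩
    have hlim : Tendsto (fun n : ℕ => 2 * (Real.sqrt 3 * metricInradius *
        (1 / 9 : ℝ) ^ ((1 : ℝ) / ((n - 1 : ℕ) : ℝ))) - 1) atTop (𝓝 (2 - Real.sqrt 3)) := by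
      have h := ((tendsto_rpow_one_div_sub_one.const_mul (Real.sqrt 3 * metricInradius)).const_mul
        2).sub_const 1
      have hval : 2 * (Real.sqrt 3 * metricInradius * 1) - 1 = 2 - Real.sqrt 3 := by
        unfold metricInradius
        linarith [sqrt_three_mul_self]
      rwa [hval] at h
    refine tendsto_of_tendsto_of_tendsto_of_le_of_le' hlim tendsto_const_nhds ?_ ?_
    · filter_upwards [eventually_ge_atTop 3] with n hn using (hm n hn).2.1
    · filter_upwards [eventually_ge_atTop 3] with n hn using (hm n hn).2.2
  · have h1 : 1.725 < Real.sqrt 3 := by rw [Real.lt_sqrt] <;> norm_num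
    have h2 : Real.sqrt 3 < 1.735 := by rw [Real.sqrt_lt'] <;> norm_num
    rw [abs_lt]
    constructor <;> linarith
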